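/- **Notation.** Let $\psi_n(x)=(2^n n!\sqrt{\pi})^{-1/2}H_n(x)e^{-x^2/2}$ be the Hermite functions ($H_n$ the physicists' Hermite polynomials) and, for $n=(n_1,\dots,n_s)\in\mathbb N^s$, let $|n_1,\dots,n_s\rangle=\psi_{n_1}\otimes\dots\otimes\psi_{n_s}\in L^2(\mathbb R^s)$ be the Fock states. A diagram is a finite graph whose wires carry the space $L^2(\mathbb R)$ and whose nodes are interpreted as follows: a Fock spider labelled by $g:\mathbb N\to\mathbb C$ is $\sum_n g(n)\,|n\rangle^{\otimes b}\langle n|^{\otimes a}$ (we write $c^{\hat n}$ for the label $g(n)=c^n$, with $0^0=1$); a W node with $k$ legs is $\sum_{n_1,\dots,n_k}\sqrt{(\sum_i n_i)!/\prod_i n_i!}\;|\sum_i n_i\rangle\langle n_1,\dots,n_k|$ or its transpose; a multiplier labelled by $m\neq 0$ is $\int|mx\rangle\langle x|\,dx$, with Fock coefficients $\langle a|\cdot|b\rangle=\int\psi_a(mx)\psi_b(x)\,dx$. Joining wires means summing over the Fock basis on them. **Circuit.** Let $s\in\mathbb N$, $r_1,\dots,r_s\in\mathbb R$, and let $U=(u_{ij})$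 be an $s\times s$ unitary matrix. The Gaussian boson sampling circuit with squeezing parameters $r_j$ and interferometer $U$ is the following diagram with $s$ outputs. On each mode $j$ the vacuum $|0\rangle$ is followed by the squeezing gate $S(r_j)$, which is $e^{-r_j/2}$ times the multiplier labelled $e^{-r_j}$. The result enters the $j$-th input W node, which has $s$ legs. The $i$-th output is the distinguished leg of the $i$-th output W node, which has $s$ legs. For all $i,j$ the $j$-th input W node and the $i$-th output W node are joined by an edge that carries a Fock spider labelled $u_{ij}^{\hat n}$. **Theorem.** The circuit is equal to the following normal form. It consists of $s$ W nodes; the distinguished leg of the $i$-th one is the $i$-th output. For each pair $i<j$ the $i$-th and the $j$-th W node are joined by an edge that carries a Fock spider labelled $a_{ij}^{\hat n}$, where $$A=(a_{ij})=-\,U\,\mathrm{diag}(\tanh r_1,\dots,\tanh r_s)\,U^{T}.$$ The $i$-th W node has in addition a self-loop that carries a Fock spider labelled $T_i^{\hat n}$, where $$T_i=-\frac12\sum_{j=1}^s \tanh(r_j)\,u_{ij}^2 .$$ The diagram is multiplied by the scalar $\prod_{i=1}^s(\cosh r_i)^{-1/2}$. Here equality means: in both diagrams the sums over the internal wires converge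 absolutely for every output label, the two diagrams have the same coefficient at every Fock state $|n_1,\dots,n_s\rangle$, and the two resulting expansions converge in $L^2(\mathbb R^s)$ to the same vector. -/

import Mathlib

open MeasureTheory
open scoped Matrix Nat

noncomputable section

namespace FockZX

/-! ### Hermite functions and the Fock basis of `L²(ℝˢ)` -/

/-- The physicists' Hermite polynomials: `H₀ = 1`, `H₁ = 2X`,
`Hₙ₊₂ = 2X Hₙ₊₁ - 2(n+1) Hₙ`. -/
def physHermite : ℕ → Polynomial ℝ
  | 0 => 1
  | 1 => 2 * Polynomial.X
  | (n + 2) => 2 * Polynomial.X * physHermite (n + 1) - 2 * ((n : Polynomial ℝ) + 1) * physHermite n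

/-- The Hermite function `ψₙ(x) = (2ⁿ n! √π)^(-1/2) Hₙ(x) exp(-x²/2)`. -/
def hermiteFun (n : ℕ) (x : ℝ) : ℝ :=
  (√(2 ^ n * (n ! : ℝ) * √Real.pi))⁻¹ * (physHermite n).eval x * Real.exp (-x ^ 2 / 2)

/-- The wave function of the Fock state `|n₁, …, nₛ⟩`. -/
def fockFun {s : ℕ} (n : Fin s → ℕ) (x : Fin s → ℝ) : ℂ :=
  ∏ i, (hermiteFun (n i) (x i) : ℂ)

lemma integrable_polynomial_mul_gaussian (p : Polynomial ℝ) :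
    Integrable (fun x : ℝ => p.eval x * Real.exp (-x ^ 2)) := by
  induction p using Polynomial.induction_on' with
  | add p q hp hq =>
    simp only [Polynomial.eval_add, add_mul]
    exact hp.add hq
  | monomial n a =>
    have h := integrable_rpow_mul_exp_neg_mul_sq (b := 1) one_pos (s := (n : ℝ))
      (lt_of_lt_of_le (by norm_num) (Nat.cast_nonneg n))
    simpa [mul_assoc] using h.const_mul a

lemma continuous_hermiteFun (n : ℕ) : Continuous (hermiteFun n) := by
  unfold hermiteFun
  fun_prop

lemma continuous_fockFun {s : ℕ} (n : Fin s → ℕ) : Continuous (fockFun n) := by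
  unfold fockFun
  refine continuous_finsetProd _ fun i _ => ?_
  exact Complex.continuous_ofReal.comp ((continuous_hermiteFun _).comp (continuous_apply i))

lemma integrable_hermiteFun_sq (n : ℕ) : Integrable (fun x : ℝ => hermiteFun n x ^ 2) := by
  have h := (integrable_polynomial_mul_gaussian (physHermite n ^ 2)).const_mul
    ((√(2 ^ n * (n ! : ℝ) * √Real.pi))⁻¹ ^ 2)
  refine h.congr (Filter.Eventually.of_forall fun x => ?_)
  have e : Real.exp (-x ^ 2) = Real.exp (-x ^ 2 / 2) ^ 2 := by
    rw [← Real.exp_nat_mul]; congr 1; push_cast; ring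
  simp only [hermiteFun, Polynomial.eval_pow, e]
  ring

lemma memLp_fockFun {s : ℕ} (n : Fin s → ℕ) : MemLp (fockFun n) 2 volume := by
  rw [memLp_two_iff_integrable_sq_norm (continuous_fockFun n).aestronglyMeasurable]
  have h : Integrable (fun x : Fin s → ℝ => ∏ i, hermiteFun (n i) (x i) ^ 2) :=
    Integrable.fintype_prod (f := fun i x => hermiteFun (n i) x ^ 2)
      fun i => integrable_hermiteFun_sq (n i)
  refine h.congr (Filter.Eventually.of_forall fun x => ?_)
  simp [fockFun, ← Finset.prod_pow]

/-- The Fock state `|n₁, …, nₛ⟩` as a vector of `L²(ℝˢ)`. -/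
def fockKet {s : ℕ} (n : Fin s → ℕ) : Lp ℂ 2 (volume : Measure (Fin s → ℝ)) :=
  (memLp_fockFun n).toLp (fockFun n)

/-! ### Diagrams and their interpretation -/

/-- The nodes from which diagrams are built; `E` is the set of wires of the diagram. -/
inductive Generator (E : Type) : Type
  /-- The Fock spider labelled by `g : ℕ → ℂ`. -/
  | fock (g : ℕ → ℂ) (legs : Multiset E)
  /-- The W node, with its distinguished leg `stem` (carrying the total photon number). -/
  | w (stem : E) (legs : Multiset E)
  /-- The multiplier labelled by `m`, a map from the wire `inp` to the wire `out`. -/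
  | mult (m : ℝ) (inp out : E)

namespace Generator

/-- All legs of a node. -/
def ends {E : Type} : Generator E → Multiset E
  | fock _ legs => legs
  | w stem legs => stem ::ₘ legs
  | mult _ inp out => {inp, out}

open Classical in
/-- The coefficient of a node in the Fock basis, when the wire `e` carries `ℓ e` photons:
* Fock spider: `∑ₙ g(n) |n⋯n⟩⟨n⋯n|`;
* W node: `∑ √((∑ nᵢ)! / ∏ nᵢ!) |∑ nᵢ⟩⟨n₁,…,nₖ|`;
* multiplier: `∫ |m x⟩⟨x| dx`, whose coefficients are `⟨a| · |b⟩ = ∫ ψₐ(m x) ψ_b(x) dx`. -/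
def tensor {E : Type} (ℓ : E → ℕ) : Generator E → ℂ
  | fock g legs => ∑' n : ℕ, if ∀ e ∈ legs, ℓ e = n then g n else 0
  | w stem legs =>
      if ℓ stem = (legs.map ℓ).sum then
        ((√(((ℓ stem)! : ℝ) / (legs.map fun e => ((ℓ e)! : ℝ)).prod) : ℝ) : ℂ)
      else 0
  | mult m inp out =>
      ((∫ x : ℝ, hermiteFun (ℓ out) (m * x) * hermiteFun (ℓ inp) x : ℝ) : ℂ)

end Generator

open Classical in
/-- A diagram without inputs and with `s` outputs: finitely many nodes joined by finitely many
wires, and a global scalar.  Each wire has exactly two ends, each of them a leg of a node or an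
output of the diagram. -/
structure Diagram (E : Type) [Fintype E] (s : ℕ) where
  nodes : Multiset (Generator E)
  out : Fin s → E
  scalar : ℂ
  two_ends : ∀ e, (nodes.bind Generator.ends).count e +
    (Finset.univ.val.map out).count e = 2

namespace Diagram

variable {E : Type} [Fintype E] {s : ℕ}

/-- The Fock labellings of the wires that put `n i` photons on the `i`-th output. -/
def Labelling (D : Diagram E s) (n : Fin s → ℕ) : Type :=
  {ℓ : E → ℕ // ∀ i, ℓ (D.out i) = n i}

/-- The contribution of one labelling of the wires. -/
def weight (D : Diagram E s) (ℓ : E → ℕ) : ℂ :=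
  (D.nodes.map (Generator.tensor ℓ)).prod

/-- The coefficient of the diagram at `|n₁, …, nₛ⟩`: every internal wire is contracted, that is,
summed over its Fock labels. -/
def amplitude (D : Diagram E s) (n : Fin s → ℕ) : ℂ :=
  D.scalar * ∑' ℓ : D.Labelling n, D.weight ℓ.1

/-- The diagram is interpreted as the vector `Ψ ∈ L²(ℝˢ)`: the contractions converge
absolutely, and `Ψ = ∑ₙ amplitude(n) |n⟩` with convergence in `L²(ℝˢ)`. -/
def Denotes (D : Diagram E s) (Ψ : Lp ℂ 2 (volume : Measure (Fin s → ℝ))) : Prop :=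
  (∀ n, Summable fun ℓ : D.Labelling n => D.weight ℓ.1) ∧
    HasSum (fun n => D.amplitude n • fockKet n) Ψ

end Diagram

lemma count_map_univ {ι E : Type} [Fintype ι] [DecidableEq E] (f : ι → E) (e : E) :
    (Finset.univ.val.map f).count e = ∑ x, if e = f x then 1 else 0 := by
  rw [Multiset.count_map, Finset.sum_boole]
  rfl

lemma sum_map_univ {ι : Type} [Fintype ι] (f : ι → ℕ) :
    (Finset.univ.val.map f).sum = ∑ x, f x := rfl

/-! ### The Gaussian boson sampling circuit -/

/-- The wires of the circuit on `s` modes. -/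
inductive CircuitWire (s : ℕ) : Type
  /-- from the `j`-th vacuum state to the `j`-th multiplier -/
  | vac (j : Fin s)
  /-- from the `j`-th multiplier to the `j`-th input W node -/
  | inp (j : Fin s)
  /-- from the `j`-th input W node to the Fock spider between input `j` and output `i` -/
  | left (j i : Fin s)
  /-- from that Fock spider to the `i`-th output W node -/
  | right (j i : Fin s)
  /-- the `i`-th output -/
  | out (i : Fin s)
  deriving DecidableEq, Fintype

/-- The nodes of the circuit.  On each mode `j` a vacuum state `|0⟩` and a multiplier labelled
`exp(-rⱼ)`; then the interferometer, a layer of input W nodes and a layer of output W nodes, with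
a Fock spider labelled `(uᵢⱼ)ⁿ` on the edge from the `j`-th input to the `i`-th output. -/
def circuitNodes {s : ℕ} (U : Matrix (Fin s) (Fin s) ℂ) (r : Fin s → ℝ) :
    Multiset (Generator (CircuitWire s)) :=
  (Finset.univ : Finset (Fin s)).val.map
      (fun j => .fock (fun n => if n = 0 then 1 else 0) {.vac j}) +
  (Finset.univ : Finset (Fin s)).val.map
      (fun j => .mult (Real.exp (-r j)) (.vac j) (.inp j)) +
  (Finset.univ : Finset (Fin s)).val.map
      (fun j => .w (.inp j) (Finset.univ.val.map fun i => .left j i)) +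
  (Finset.univ : Finset (Fin s × Fin s)).val.map
      (fun p => .fock (fun n => U p.2 p.1 ^ n) {.left p.1 p.2, .right p.1 p.2}) +
  (Finset.univ : Finset (Fin s)).val.map
      (fun i => .w (.out i) (Finset.univ.val.map fun j => .right j i))

/-- The Gaussian boson sampling circuit: squeezed vacuum states fed into the interferometer with
matrix `U`.  The factors `exp(-rⱼ/2)` turn the multipliers `∫ |exp(-rⱼ) x⟩⟨x| dx` into the unitary
squeezing gates `S(rⱼ)`. -/
def gbsCircuit {s : ℕ} (U : Matrix (Fin s) (Fin s) ℂ) (r : Fin s → ℝ) :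
    Diagram (CircuitWire s) s where
  nodes := circuitNodes U r
  out := .out
  scalar := ∏ j, (Real.exp (-r j / 2) : ℂ)
  two_ends := by
    intro e
    simp only [circuitNodes, Multiset.add_bind, Multiset.count_add, Multiset.bind_map,
      Multiset.count_bind, Generator.ends, Multiset.count_cons, Multiset.count_singleton,
      count_map_univ, sum_map_univ, Multiset.insert_eq_cons, Finset.sum_add_distrib,
      Fintype.sum_prod_type]
    cases e <;> simp [ite_and, Finset.sum_ite_eq]

/-! ### The normal form -/

/-- The wires of a complete graph of W nodes with self-loops. -/
inductive GraphWire (s : ℕ) : Type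
  /-- the `i`-th output -/
  | out (i : Fin s)
  /-- from the W node `p.1` to the Fock spider on the edge between the W nodes `p.1`, `p.2` -/
  | half (p : {p : Fin s × Fin s // p.1 ≠ p.2})
  /-- the two wires between the `i`-th W node and the Fock spider on its self-loop -/
  | loop (i : Fin s) (b : Bool)
  deriving DecidableEq, Fintype

/-- The nodes of the complete graph: the W nodes, one for each output; on the edge between the
`i`-th and the `j`-th W node, `i < j`, a Fock spider labelled `(aᵢⱼ)ⁿ`; on the self-loop of the
`i`-th W node a Fock spider labelled `(tᵢ)ⁿ`. -/
def graphNodes {s : ℕ} (A : Matrix (Fin s) (Fin s) ℂ) (t : Fin s → ℂ) :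
    Multiset (Generator (GraphWire s)) :=
  (Finset.univ : Finset (Fin s)).val.map
      (fun i => .w (.out i)
        ((Finset.univ : Finset {j : Fin s // i ≠ j}).val.map (fun j => .half ⟨(i, j.1), j.2⟩) +
          {.loop i false, .loop i true})) +
  (Finset.univ : Finset {p : Fin s × Fin s // p.1 < p.2}).val.map
      (fun p => .fock (fun n => A p.1.1 p.1.2 ^ n)
        {.half ⟨(p.1.1, p.1.2), p.2.ne⟩, .half ⟨(p.1.2, p.1.1), p.2.ne'⟩}) +
  (Finset.univ : Finset (Fin s)).val.map
      (fun i => .fock (fun n => t i ^ n) {.loop i false, .loop i true})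

/-- The complete graph of W nodes with edge labels `A`, self-loop labels `t` and global scalar
`c`.  Only the off-diagonal entries of the symmetric matrix `A` are used. -/
def graphDiagram {s : ℕ} (A : Matrix (Fin s) (Fin s) ℂ) (t : Fin s → ℂ) (c : ℂ) :
    Diagram (GraphWire s) s where
  nodes := graphNodes A t
  out := .out
  scalar := c
  two_ends := by
    intro e
    simp only [graphNodes, Multiset.add_bind, Multiset.count_add, Multiset.bind_map,
      Multiset.count_bind, Generator.ends, Multiset.count_cons, Multiset.count_singleton,
      count_map_univ, sum_map_univ, Multiset.insert_eq_cons, Finset.sum_add_distrib]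
    cases e with
    | out i => simp
    | loop i b => cases b <;> simp
    | half p =>
      obtain ⟨⟨i, j⟩, h⟩ := p
      replace h : i ≠ j := h
      have h₁ : (∑ x : Fin s, ∑ y : {y : Fin s // x ≠ y},
          if GraphWire.half ⟨(i, j), h⟩ = GraphWire.half ⟨(x, y.1), y.2⟩ then 1 else 0) = 1 := by
        rw [Finset.sum_eq_single i, Finset.sum_eq_single ⟨j, h⟩]
        · simp
        · rintro ⟨y, hy⟩ - hne
          have : j ≠ y := fun e => hne (by simp [e])
          simp [this]
        · simp
        · rintro x - hx
          simp [hx.symm]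
        · simp
      have h₂ : ((∑ x : {p : Fin s × Fin s // p.1 < p.2},
          if GraphWire.half ⟨(i, j), h⟩ = GraphWire.half ⟨(x.1.2, x.1.1), x.2.ne'⟩ then 1 else 0) +
          ∑ x : {p : Fin s × Fin s // p.1 < p.2},
          if GraphWire.half ⟨(i, j), h⟩ = GraphWire.half ⟨(x.1.1, x.1.2), x.2.ne⟩ then 1 else 0)
            = 1 := by
        rcases lt_or_gt_of_ne h with hl | hl
        · rw [Finset.sum_eq_zero, Finset.sum_eq_single ⟨(i, j), hl⟩]
          · simp
          · rintro ⟨⟨a, b⟩, hab⟩ - hne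
            rw [if_neg]
            intro e
            simp only [GraphWire.half.injEq, Subtype.mk.injEq, Prod.mk.injEq] at e
            exact hne (by simp [e.1, e.2])
          · simp
          · rintro ⟨⟨a, b⟩, hab⟩ -
            rw [if_neg]
            intro e
            simp only [GraphWire.half.injEq, Subtype.mk.injEq, Prod.mk.injEq] at e
            exact absurd hab (by simpa [← e.1, ← e.2] using hl.le)
        · rw [Finset.sum_eq_single ⟨(j, i), hl⟩, Finset.sum_eq_zero]
          · simp
          · rintro ⟨⟨a, b⟩, hab⟩ -
            rw [if_neg]
            intro e
            simp only [GraphWire.half.injEq, Subtype.mk.injEq, Prod.mk.injEq] at e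
            exact absurd hab (by simpa [← e.1, ← e.2] using hl.le)
          · rintro ⟨⟨a, b⟩, hab⟩ - hne
            rw [if_neg]
            intro e
            simp only [GraphWire.half.injEq, Subtype.mk.injEq, Prod.mk.injEq] at e
            exact hne (by simp [e.1, e.2])
          · simp
      simp only [reduceCtorEq, if_false, Finset.sum_const_zero, add_zero]
      convert congrArg₂ (· + ·) h₁ h₂

/-- The edge labels of the normal form, `-U diag(tanh r₁, …, tanh rₛ) Uᵀ`. -/
def edgeMatrix {s : ℕ} (U : Matrix (Fin s) (Fin s) ℂ) (r : Fin s → ℝ) :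
    Matrix (Fin s) (Fin s) ℂ :=
  -(U * Matrix.diagonal (fun j => (Real.tanh (r j) : ℂ)) * Uᵀ)

/-- The self-loop labels of the normal form, `Tᵢ = -(1/2) ∑ⱼ tanh(rⱼ) uᵢⱼ²`. -/
def loopLabel {s : ℕ} (U : Matrix (Fin s) (Fin s) ℂ) (r : Fin s → ℝ) (i : Fin s) : ℂ :=
  -(1 / 2) * ∑ j, (Real.tanh (r j) : ℂ) * U i j ^ 2

/-- The normal form of the Gaussian boson sampling circuit. -/
def gbsNormalForm {s : ℕ} (U : Matrix (Fin s) (Fin s) ℂ) (r : Fin s → ℝ) :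
    Diagram (GraphWire s) s :=
  graphDiagram (edgeMatrix U r) (loopLabel U r) (∏ i, (1 / √(Real.cosh (r i)) : ℝ))

end FockZX

end

noncomputable section

namespace FockZX

/-! ### Hermite functions -/

lemma derivative_physHermite_succ (n : ℕ) :
    (physHermite (n + 1)).derivative = 2 * ((n : Polynomial ℝ) + 1) * physHermite n := by
  induction n using Nat.strong_induction_on with
  | _ n ih =>
    match n with
    | 0 => simp [physHermite]
    | 1 =>
      simp [physHermite]
      ring
    | n + 2 =>
      have h₁ := ih (n + 1) (by omega)
      have h₂ := ih n (by omega)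
      rw [physHermite]
      simp only [Polynomial.derivative_sub, Polynomial.derivative_mul, h₁, h₂,
        Polynomial.derivative_X, Polynomial.derivative_add, Polynomial.derivative_ofNat,
        Polynomial.derivative_natCast, Polynomial.derivative_one]
      rw [physHermite]
      push_cast
      ring

lemma physHermite_succ (n : ℕ) :
    physHermite (n + 1) = 2 * Polynomial.X * physHermite n - (physHermite n).derivative := by
  cases n with
  | zero => simp [physHermite]
  | succ n => rw [derivative_physHermite_succ, physHermite]

lemma integrable_polynomial_mul_exp_neg_mul_sq {b : ℝ} (hb : 0 < b) (p : Polynomial ℝ) :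
    Integrable (fun x : ℝ => p.eval x * Real.exp (-b * x ^ 2)) := by
  induction p using Polynomial.induction_on' with
  | add p q hp hq =>
    simp only [Polynomial.eval_add, add_mul]
    exact hp.add hq
  | monomial n a =>
    have h := integrable_rpow_mul_exp_neg_mul_sq hb (s := (n : ℝ))
      (lt_of_lt_of_le (by norm_num) (Nat.cast_nonneg n))
    simpa [mul_assoc] using h.const_mul a

/-- Integration by parts against a Gaussian weight. -/
lemma integral_derivative_mul_gaussian {b : ℝ} (hb : 0 < b) (p : Polynomial ℝ) :
    ∫ x : ℝ, (p.derivative - 2 * Polynomial.C b * Polynomial.X * p).eval x *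
      Real.exp (-b * x ^ 2) = 0 := by
  refine integral_eq_zero_of_hasDerivAt_of_integrable
    (f := fun x => p.eval x * Real.exp (-b * x ^ 2)) (fun x => ?_)
    (integrable_polynomial_mul_exp_neg_mul_sq hb _) (integrable_polynomial_mul_exp_neg_mul_sq hb _)
  have h : HasDerivAt (fun x : ℝ => -b * x ^ 2) (-b * (2 * x)) x := by
    simpa using (hasDerivAt_pow 2 x).const_mul (-b)
  refine ((p.hasDerivAt x).mul h.exp).congr_deriv ?_
  simp only [Polynomial.eval_sub, Polynomial.eval_mul, Polynomial.eval_ofNat, Polynomial.eval_C,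
    Polynomial.eval_X]
  ring

lemma integral_physHermite_mul_succ (p : Polynomial ℝ) (n : ℕ) :
    ∫ x : ℝ, (p * physHermite (n + 1)).eval x * Real.exp (-1 * x ^ 2) =
      ∫ x : ℝ, (p.derivative * physHermite n).eval x * Real.exp (-1 * x ^ 2) := by
  rw [← sub_eq_zero, ← integral_sub (integrable_polynomial_mul_exp_neg_mul_sq one_pos _)
    (integrable_polynomial_mul_exp_neg_mul_sq one_pos _), ← neg_eq_zero, ← integral_neg,
    ← integral_derivative_mul_gaussian one_pos (p * physHermite n)]
  refine integral_congr_ae (Filter.Eventually.of_forall fun x => ?_)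
  simp [physHermite_succ]
  ring

lemma integral_physHermite_mul_physHermite (m n : ℕ) :
    ∫ x : ℝ, (physHermite m * physHermite n).eval x * Real.exp (-1 * x ^ 2) =
      if m = n then 2 ^ n * (n ! : ℝ) * √Real.pi else 0 := by
  induction n generalizing m with
  | zero =>
    cases m with
    | zero =>
      have h := integral_gaussian 1
      simpa [physHermite] using h
    | succ m =>
      rw [mul_comm, integral_physHermite_mul_succ]
      simp [physHermite]
  | succ n ih =>
    rw [integral_physHermite_mul_succ]
    cases m with
    | zero => simp [physHermite]
    | succ m =>
      rw [derivative_physHermite_succ]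
      have h : ∀ x : ℝ, (2 * ((m : Polynomial ℝ) + 1) * physHermite m * physHermite n).eval x *
          Real.exp (-1 * x ^ 2) = 2 * ((m : ℝ) + 1) *
            ((physHermite m * physHermite n).eval x * Real.exp (-1 * x ^ 2)) := by
        intro x
        simp
        ring
      simp only [h, integral_const_mul, ih, add_left_inj]
      split_ifs with h
      · subst h
        rw [Nat.factorial_succ]
        push_cast
        ring
      · simp

lemma integral_hermiteFun_mul_hermiteFun (m n : ℕ) :
    ∫ x : ℝ, hermiteFun m x * hermiteFun n x = if m = n then 1 else 0 := by
  have h : ∀ x : ℝ, hermiteFun m x * hermiteFun n x =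
      (√(2 ^ m * (m ! : ℝ) * √Real.pi))⁻¹ * (√(2 ^ n * (n ! : ℝ) * √Real.pi))⁻¹ *
        ((physHermite m * physHermite n).eval x * Real.exp (-1 * x ^ 2)) := by
    intro x
    have e : Real.exp (-1 * x ^ 2) = Real.exp (-x ^ 2 / 2) * Real.exp (-x ^ 2 / 2) := by
      rw [← Real.exp_add]; congr 1; ring
    rw [e, Polynomial.eval_mul, hermiteFun, hermiteFun]
    ring
  simp only [h, integral_const_mul, integral_physHermite_mul_physHermite]
  split_ifs with hmn
  · subst hmn
    have hp : 0 < 2 ^ m * (m ! : ℝ) * √Real.pi := by positivity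
    rw [← mul_inv, Real.mul_self_sqrt hp.le, inv_mul_cancel₀ hp.ne']
  · simp

lemma orthonormal_fockKet (s : ℕ) : Orthonormal ℂ (fockKet (s := s)) := by
  classical
  rw [orthonormal_iff_ite]
  intro m n
  have h : inner ℂ (fockKet m) (fockKet n) =
      ∫ x : Fin s → ℝ, ∏ i, ((hermiteFun (m i) (x i) * hermiteFun (n i) (x i) : ℝ) : ℂ) := by
    rw [L2.inner_def]
    refine integral_congr_ae ?_
    filter_upwards [(memLp_fockFun m).coeFn_toLp, (memLp_fockFun n).coeFn_toLp] with x hm hn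
    rw [fockKet, fockKet, hm, hn, fockFun, fockFun, RCLike.inner_apply, map_prod,
      ← Finset.prod_mul_distrib]
    refine Finset.prod_congr rfl fun i _ => ?_
    rw [Complex.conj_ofReal, Complex.ofReal_mul, mul_comm]
  rw [h, integral_fintype_prod_volume_eq_prod
    (fun i (x : ℝ) => ((hermiteFun (m i) x * hermiteFun (n i) x : ℝ) : ℂ))]
  simp only [integral_complex_ofReal, integral_hermiteFun_mul_hermiteFun]
  split_ifs with hmn
  · simp [hmn]
  · obtain ⟨i, hi⟩ := Function.ne_iff.1 hmn
    exact Finset.prod_eq_zero (Finset.mem_univ i) (by simp [hi])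

/-! ### The squeezed vacuum -/

lemma integral_physHermite_comp_mul_gaussian (m : ℝ) (n : ℕ) :
    ∫ x : ℝ, ((physHermite (n + 2)).comp (Polynomial.C m * Polynomial.X)).eval x *
        Real.exp (-((m ^ 2 + 1) / 2) * x ^ 2) =
      2 * (n + 1) * ((m ^ 2 - 1) / (m ^ 2 + 1)) *
        ∫ x : ℝ, ((physHermite n).comp (Polynomial.C m * Polynomial.X)).eval x *
          Real.exp (-((m ^ 2 + 1) / 2) * x ^ 2) := by
  have hb : 0 < (m ^ 2 + 1) / 2 := by positivity
  have hp := integral_derivative_mul_gaussian hb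
    ((physHermite (n + 1)).comp (Polynomial.C m * Polynomial.X))
  rw [← sub_eq_zero, ← integral_const_mul,
    ← integral_sub (integrable_polynomial_mul_exp_neg_mul_sq hb _)
      ((integrable_polynomial_mul_exp_neg_mul_sq hb _).const_mul _)]
  replace hp := congrArg (-(2 * m / (m ^ 2 + 1)) * ·) hp
  simp only [mul_zero, ← integral_const_mul] at hp
  refine Eq.trans ?_ hp
  refine integral_congr_ae (Filter.Eventually.of_forall fun x => ?_)
  simp [Polynomial.derivative_comp, derivative_physHermite_succ, physHermite.eq_3]
  field_simp
  ring

lemma integral_physHermite_zero_comp_mul_gaussian (m : ℝ) :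
    ∫ x : ℝ, ((physHermite 0).comp (Polynomial.C m * Polynomial.X)).eval x *
        Real.exp (-((m ^ 2 + 1) / 2) * x ^ 2) = √(2 * Real.pi / (m ^ 2 + 1)) := by
  have h := integral_gaussian ((m ^ 2 + 1) / 2)
  simp only [physHermite, Polynomial.one_comp, Polynomial.eval_one, one_mul]
  rw [h]
  congr 1
  field_simp

lemma integral_physHermite_one_comp_mul_gaussian (m : ℝ) :
    ∫ x : ℝ, ((physHermite 1).comp (Polynomial.C m * Polynomial.X)).eval x *
        Real.exp (-((m ^ 2 + 1) / 2) * x ^ 2) = 0 := by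
  have hb : 0 < (m ^ 2 + 1) / 2 := by positivity
  have hp := congrArg (-(2 * m / (m ^ 2 + 1)) * ·) (integral_derivative_mul_gaussian hb 1)
  simp only [mul_zero, ← integral_const_mul] at hp
  refine Eq.trans ?_ hp
  refine integral_congr_ae (Filter.Eventually.of_forall fun x => ?_)
  simp [physHermite]
  field_simp

lemma integral_physHermite_comp_eq (m : ℝ) (n : ℕ) :
    ∫ x : ℝ, ((physHermite n).comp (Polynomial.C m * Polynomial.X)).eval x *
        Real.exp (-((m ^ 2 + 1) / 2) * x ^ 2) =
      if Even n then (n ! : ℝ) / ((n / 2)! : ℝ) * ((m ^ 2 - 1) / (m ^ 2 + 1)) ^ (n / 2) *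
        √(2 * Real.pi / (m ^ 2 + 1)) else 0 := by
  induction n using Nat.twoStepInduction with
  | zero =>
    rw [integral_physHermite_zero_comp_mul_gaussian]
    simp
  | one =>
    rw [integral_physHermite_one_comp_mul_gaussian]
    simp
  | more n ih _ =>
    rw [integral_physHermite_comp_mul_gaussian, ih]
    simp only [Nat.even_add, even_two, iff_true]
    split_ifs with h
    · obtain ⟨k, rfl⟩ := h
      have e₁ : (k + k) / 2 = k := by omega
      have e₂ : (k + k + 2) / 2 = k + 1 := by omega
      rw [e₁, e₂, Nat.factorial_succ, Nat.factorial_succ, Nat.factorial_succ k]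
      generalize (m ^ 2 - 1) / (m ^ 2 + 1) = c
      push_cast
      field_simp
      ring
    · simp

/-- The Fock coefficients of the squeezed vacuum `S(r)|0⟩`. -/
lemma squeezed_vacuum_coeff (r : ℝ) (n : ℕ) :
    Real.exp (-r / 2) * ∫ x : ℝ, hermiteFun n (Real.exp (-r) * x) * hermiteFun 0 x =
      1 / √(Real.cosh r) *
        if Even n then √(n ! : ℝ) * ((-(Real.tanh r / 2)) ^ (n / 2) / ((n / 2)! : ℝ)) else 0 := by
  set m := Real.exp (-r) with hm
  have hm0 : 0 < m := Real.exp_pos _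
  have h : ∀ x : ℝ, hermiteFun n (m * x) * hermiteFun 0 x =
      (√(2 ^ n * (n ! : ℝ) * √Real.pi))⁻¹ * (√√Real.pi)⁻¹ *
        (((physHermite n).comp (Polynomial.C m * Polynomial.X)).eval x *
          Real.exp (-((m ^ 2 + 1) / 2) * x ^ 2)) := by
    intro x
    have e : Real.exp (-((m ^ 2 + 1) / 2) * x ^ 2) =
        Real.exp (-(m * x) ^ 2 / 2) * Real.exp (-x ^ 2 / 2) := by
      rw [← Real.exp_add]; congr 1; ring
    rw [e, hermiteFun, hermiteFun]
    simp [physHermite]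
    ring
  simp only [h, integral_const_mul, integral_physHermite_comp_eq]
  split_ifs with hn
  · obtain ⟨k, rfl⟩ := hn
    have e₁ : (k + k) / 2 = k := by omega
    have hE : Real.exp r = m⁻¹ := by rw [hm, Real.exp_neg, inv_inv]
    have ht : (m ^ 2 - 1) / (m ^ 2 + 1) = -Real.tanh r := by
      rw [Real.tanh_eq_sinh_div_cosh, Real.sinh_eq, Real.cosh_eq, ← hm, hE]
      field_simp
      ring
    have hc : Real.exp (-r / 2) * √(2 * Real.pi / (m ^ 2 + 1)) = √Real.pi / √(Real.cosh r) := by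
      have : Real.exp (-r / 2) = √m := by
        rw [hm, ← Real.exp_half]
      rw [this, ← Real.sqrt_mul hm0.le, ← Real.sqrt_div Real.pi_pos.le, Real.cosh_eq, ← hm, hE]
      congr 1
      field_simp
      ring
    have hf : √(2 ^ (k + k) * ((k + k)! : ℝ) * √Real.pi) =
        2 ^ k * √((k + k)! : ℝ) * √√Real.pi := by
      rw [Real.sqrt_mul (by positivity), Real.sqrt_mul (by positivity), ← two_mul, pow_mul',
        Real.sqrt_sq (by positivity)]
    have hs : √((k + k)! : ℝ) * √((k + k)! : ℝ) = ((k + k)! : ℝ) :=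
      Real.mul_self_sqrt (by positivity)
    have hpi : √√Real.pi * √√Real.pi = √Real.pi := Real.mul_self_sqrt (by positivity)
    have hcosh : 0 < Real.cosh r := Real.cosh_pos r
    rw [e₁, ht, hf]
    calc _ = (2 ^ k * √((k + k)! : ℝ) * √√Real.pi)⁻¹ * (√√Real.pi)⁻¹ *
        (((k + k)! : ℝ) / (k ! : ℝ) * (-Real.tanh r) ^ k) *
          (Real.exp (-r / 2) * √(2 * Real.pi / (m ^ 2 + 1))) := by ring
      _ = _ := by
        rw [hc, ← neg_div, div_pow]
        have : √((k + k)! : ℝ) ≠ 0 := by positivity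
        have : √√Real.pi ≠ 0 := by positivity
        have : √(Real.cosh r) ≠ 0 := by positivity
        field_simp
        rw [sq, sq, hs, hpi]
        ring
  · simp

/-! ### The Fischer pairing of polynomials -/

open MvPolynomial

section Fischer

variable {σ : Type*} [Fintype σ]

/-- The Fischer pairing `⟨P, Q⟩ = ∑ₙ n! Pₙ Qₙ` of polynomials. -/
def fischer (P Q : MvPolynomial σ ℂ) : ℂ :=
  ∑ n ∈ P.support, (∏ i, ((n i)! : ℂ)) * coeff n P * coeff n Q

lemma fischer_eq_sum {P : MvPolynomial σ ℂ} (Q : MvPolynomial σ ℂ) {F : Finset (σ →₀ ℕ)}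
    (h : P.support ⊆ F) :
    fischer P Q = ∑ n ∈ F, (∏ i, ((n i)! : ℂ)) * coeff n P * coeff n Q :=
  Finset.sum_subset h fun n _ hn => by simp [notMem_support_iff.1 hn]

lemma fischer_add_left (P P' Q : MvPolynomial σ ℂ) :
    fischer (P + P') Q = fischer P Q + fischer P' Q := by
  classical
  have h : (P + P').support ⊆ P.support ∪ P'.support := support_add
  rw [fischer_eq_sum Q h, fischer_eq_sum Q Finset.subset_union_left,
    fischer_eq_sum Q (Finset.subset_union_right (s₁ := P.support)), ← Finset.sum_add_distrib]
  refine Finset.sum_congr rfl fun n _ => ?_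
  rw [coeff_add]
  ring

lemma fischer_C_mul_left (a : ℂ) (P Q : MvPolynomial σ ℂ) :
    fischer (C a * P) Q = a * fischer P Q := by
  have h : (C a * P).support ⊆ P.support := fun n hn => by
    simp only [mem_support_iff, coeff_C_mul] at hn ⊢
    exact right_ne_zero_of_mul hn
  rw [fischer_eq_sum Q h, fischer, Finset.mul_sum]
  refine Finset.sum_congr rfl fun n _ => ?_
  rw [coeff_C_mul]
  ring

lemma fischer_sum_left {ι : Type*} (t : Finset ι) (P : ι → MvPolynomial σ ℂ)
    (Q : MvPolynomial σ ℂ) : fischer (∑ k ∈ t, P k) Q = ∑ k ∈ t, fischer (P k) Q := by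
  classical
  induction t using Finset.induction_on with
  | empty => simp [fischer]
  | insert a t ha ih => rw [Finset.sum_insert ha, Finset.sum_insert ha, fischer_add_left, ih]

lemma fischer_sum_right {ι : Type*} (t : Finset ι) (P : MvPolynomial σ ℂ)
    (Q : ι → MvPolynomial σ ℂ) : fischer P (∑ k ∈ t, Q k) = ∑ k ∈ t, fischer P (Q k) := by
  simp only [fischer, coeff_sum, Finset.mul_sum]
  exact Finset.sum_comm

lemma fischer_C_mul_right (a : ℂ) (P Q : MvPolynomial σ ℂ) :
    fischer P (C a * Q) = a * fischer P Q := by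
  simp only [fischer, coeff_C_mul, Finset.mul_sum]
  exact Finset.sum_congr rfl fun n _ => by ring

lemma fischer_monomial_left (n : σ →₀ ℕ) (a : ℂ) (Q : MvPolynomial σ ℂ) :
    fischer (monomial n a) Q = (∏ i, ((n i)! : ℂ)) * a * coeff n Q := by
  classical
  rw [fischer_eq_sum Q support_monomial_subset]
  simp [coeff_monomial]

/-- Multiplication by a variable is adjoint to differentiation. -/
lemma fischer_mul_X (P Q : MvPolynomial σ ℂ) (i : σ) :
    fischer (P * X i) Q = fischer P (pderiv i Q) := by
  classical
  rw [fischer, support_mul_X, Finset.sum_map, fischer]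
  refine Finset.sum_congr rfl fun n _ => ?_
  have h : (∏ j, (((n + Finsupp.single i 1 : σ →₀ ℕ) j)! : ℂ)) = (n i + 1) * ∏ j, ((n j)! : ℂ) := by
    rw [← Finset.mul_prod_erase _ _ (Finset.mem_univ i),
      ← Finset.mul_prod_erase Finset.univ (fun j => ((n j)! : ℂ)) (Finset.mem_univ i),
      ← mul_assoc]
    congr 1
    · simp [Nat.factorial_succ]
    · refine Finset.prod_congr rfl fun j hj => ?_
      simp [(Finset.ne_of_mem_erase hj).symm]
  simp only [addRightEmbedding_apply]
  rw [h, coeff_mul_X, coeff_pderiv]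
  ring

/-! ### Linear substitutions -/

/-- The substitution `zⱼ ↦ ∑ᵢ Uᵢⱼ zᵢ`. -/
def linSubst (U : Matrix σ σ ℂ) : MvPolynomial σ ℂ →ₐ[ℂ] MvPolynomial σ ℂ :=
  aeval fun j => ∑ i, C (U i j) * X i

@[simp]
lemma linSubst_X (U : Matrix σ σ ℂ) (j : σ) : linSubst U (X j) = ∑ i, C (U i j) * X i :=
  aeval_X _ _

@[simp]
lemma linSubst_C (U : Matrix σ σ ℂ) (a : ℂ) : linSubst U (C a) = C a :=
  aeval_C _ _

lemma linSubst_linSubst (U V : Matrix σ σ ℂ) (P : MvPolynomial σ ℂ) :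
    linSubst U (linSubst V P) = linSubst (U * V) P := by
  have h : (linSubst U).comp (linSubst V) = linSubst (U * V) := by
    refine algHom_ext fun j => ?_
    simp only [AlgHom.comp_apply, linSubst_X, map_sum, map_mul, linSubst_C, Matrix.mul_apply,
      Finset.mul_sum, Finset.sum_mul]
    rw [Finset.sum_comm]
    refine Finset.sum_congr rfl fun i _ => Finset.sum_congr rfl fun k _ => ?_
    ring
  exact DFunLike.congr_fun h P

lemma linSubst_one [DecidableEq σ] (P : MvPolynomial σ ℂ) :
    linSubst (1 : Matrix σ σ ℂ) P = P := by
  have h : linSubst (1 : Matrix σ σ ℂ) = AlgHom.id ℂ _ := by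
    refine algHom_ext fun j => ?_
    simp [Matrix.one_apply, apply_ite C, ite_mul]
  exact DFunLike.congr_fun h P

lemma coeff_zero_linSubst (U : Matrix σ σ ℂ) (P : MvPolynomial σ ℂ) :
    coeff 0 (linSubst U P) = coeff 0 P := by
  simp only [← constantCoeff_eq]
  induction P using MvPolynomial.induction_on with
  | C a => simp
  | add P Q hP hQ => simp [hP, hQ]
  | mul_X P j _ => simp

lemma pderiv_linSubst (U : Matrix σ σ ℂ) (j : σ) (P : MvPolynomial σ ℂ) :
    pderiv j (linSubst U P) = ∑ i, C (U j i) * linSubst U (pderiv i P) := by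
  classical
  induction P using MvPolynomial.induction_on with
  | C a => simp
  | add P Q hP hQ => simp [hP, hQ, mul_add, Finset.sum_add_distrib]
  | mul_X P k hP =>
    have h : pderiv j (∑ i, C (U i k) * X i : MvPolynomial σ ℂ) = C (U j k) := by
      simp [map_sum, pderiv_X, Pi.single_apply]
    have h' : ∀ i, linSubst U (pderiv i (X k)) = if k = i then 1 else 0 := by
      intro i
      rw [pderiv_X, Pi.single_apply]
      split_ifs <;> simp
    simp only [map_mul, linSubst_X, pderiv_mul, hP, h, map_add, h', mul_add,
      Finset.sum_add_distrib, Finset.sum_mul]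
    congr 1
    · exact Finset.sum_congr rfl fun i _ => by ring
    · simp [mul_comm]

/-- A linear substitution is adjoint to the transposed one. -/
lemma fischer_linSubst (U : Matrix σ σ ℂ) (P Q : MvPolynomial σ ℂ) :
    fischer (linSubst U P) Q = fischer P (linSubst Uᵀ Q) := by
  induction P using MvPolynomial.induction_on generalizing Q with
  | C a =>
    rw [linSubst_C, ← monomial_zero', fischer_monomial_left, fischer_monomial_left,
      coeff_zero_linSubst]
  | add P P' hP hP' => rw [map_add, fischer_add_left, fischer_add_left, hP, hP']
  | mul_X P j hP =>
    have h : linSubst U (P * X j) = ∑ i, C (U i j) * (linSubst U P * X i) := by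
      rw [map_mul, linSubst_X, Finset.mul_sum]
      exact Finset.sum_congr rfl fun i _ => by ring
    simp only [h, fischer_sum_left, fischer_C_mul_left, fischer_mul_X, hP, pderiv_linSubst,
      fischer_sum_right, fischer_C_mul_right, Matrix.transpose_apply]

/-- The squared Bombieri norm `∑ₙ n! |Pₙ|²`. -/
def bombieriSq (P : MvPolynomial σ ℂ) : ℝ :=
  ∑ n ∈ P.support, (∏ i, ((n i)! : ℝ)) * ‖coeff n P‖ ^ 2

lemma fischer_conj (P : MvPolynomial σ ℂ) :
    fischer P (map (starRingEnd ℂ) P) = (bombieriSq P : ℂ) := by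
  rw [fischer, bombieriSq]
  push_cast
  refine Finset.sum_congr rfl fun n _ => ?_
  rw [coeff_map, mul_assoc, Complex.mul_conj']

lemma map_conj_linSubst (U : Matrix σ σ ℂ) (P : MvPolynomial σ ℂ) :
    map (starRingEnd ℂ) (linSubst U P) =
      linSubst (U.map (starRingEnd ℂ)) (map (starRingEnd ℂ) P) := by
  induction P using MvPolynomial.induction_on with
  | C a => simp
  | add P Q hP hQ => simp [hP, hQ]
  | mul_X P j hP => simp [hP]

/-- The Bombieri norm is invariant under unitary substitutions. -/
lemma bombieriSq_linSubst [DecidableEq σ] {U : Matrix σ σ ℂ} (hU : U ∈ Matrix.unitaryGroup σ ℂ)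
    (P : MvPolynomial σ ℂ) : bombieriSq (linSubst U P) = bombieriSq P := by
  have h : Uᵀ * U.map (starRingEnd ℂ) = 1 := by
    have h := congrArg Matrix.transpose (Matrix.mem_unitaryGroup_iff'.1 hU)
    rw [Matrix.transpose_mul, Matrix.transpose_one] at h
    exact h
  rw [← Complex.ofReal_inj, ← fischer_conj, ← fischer_conj, fischer_linSubst, map_conj_linSubst,
    linSubst_linSubst, h, linSubst_one]

lemma sum_le_bombieriSq (P : MvPolynomial σ ℂ) (F : Finset (σ → ℕ)) :
    ∑ n ∈ F, (∏ i, ((n i)! : ℝ)) * ‖coeff (Finsupp.equivFunOnFinite.symm n) P‖ ^ 2 ≤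
      bombieriSq P := by
  have h := Finset.sum_map F Finsupp.equivFunOnFinite.symm.toEmbedding
    (fun n => (∏ i, ((n i)! : ℝ)) * ‖coeff n P‖ ^ 2)
  simp only [Equiv.coe_toEmbedding, Finsupp.equivFunOnFinite_symm_apply_apply] at h
  classical
  rw [← h, bombieriSq]
  refine (Finset.sum_le_sum_of_subset_of_nonneg (Finset.subset_union_left (s₂ := P.support))
    fun n _ _ => by positivity).trans_eq (Finset.sum_subset Finset.subset_union_right ?_).symm
  intro n _ hn
  simp [notMem_support_iff.1 hn]

/-! ### Divided powers of quadratic forms -/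

lemma divided_pow_sum {ι A : Type*} [Fintype ι] [DecidableEq ι] [CommRing A] [Algebra ℂ A]
    (f : ι → A) (d : ℕ) :
    algebraMap ℂ A (d ! : ℂ)⁻¹ * (∑ i, f i) ^ d =
      ∑ k ∈ Finset.univ.piAntidiag d, ∏ i, (algebraMap ℂ A ((k i)! : ℂ)⁻¹ * f i ^ k i) := by
  rw [Finset.sum_pow_eq_sum_piAntidiag, Finset.mul_sum]
  refine Finset.sum_congr rfl fun k hk => ?_
  have hs : ∑ i, k i = d := (Finset.mem_piAntidiag.1 hk).1
  have hm := Nat.multinomial_spec Finset.univ k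
  rw [hs] at hm
  rw [Finset.prod_mul_distrib, ← mul_assoc, ← map_prod, ← map_natCast (algebraMap ℂ A), ← map_mul]
  congr 2
  have h₁ : (d ! : ℂ) ≠ 0 := Nat.cast_ne_zero.2 (Nat.factorial_ne_zero d)
  have h₂ : (∏ i, ((k i)! : ℂ)) ≠ 0 :=
    Finset.prod_ne_zero_iff.2 fun i _ => Nat.cast_ne_zero.2 (Nat.factorial_ne_zero _)
  rw [Finset.prod_inv_distrib, inv_mul_eq_div, div_eq_iff h₁, ← hm]
  push_cast
  field_simp

/-- The divided power `(∑ⱼ τⱼ zⱼ²)ᵈ / d!`. -/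
def diagPow (τ : σ → ℂ) (d : ℕ) : MvPolynomial σ ℂ :=
  C (d ! : ℂ)⁻¹ * (∑ j, C (τ j) * X j ^ 2) ^ d

lemma diagPow_eq_sum [DecidableEq σ] (τ : σ → ℂ) (d : ℕ) :
    diagPow τ d = ∑ p ∈ Finset.univ.piAntidiag d,
      monomial (Finsupp.equivFunOnFinite.symm (2 * p)) (∏ j, (τ j ^ p j / (p j)!)) := by
  rw [diagPow]
  refine (divided_pow_sum _ d).trans (Finset.sum_congr rfl fun p _ => ?_)
  rw [monomial_eq, map_prod, Finsupp.prod_fintype _ _ (by simp), ← Finset.prod_mul_distrib]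
  refine Finset.prod_congr rfl fun j _ => ?_
  simp only [algebraMap_eq, mul_pow, ← pow_mul, Finsupp.equivFunOnFinite_symm_apply_apply,
    Pi.mul_apply, Pi.ofNat_apply, div_eq_mul_inv, map_mul, map_pow]
  ring

lemma coeff_diagPow (τ : σ → ℂ) (p : σ → ℕ) :
    coeff (Finsupp.equivFunOnFinite.symm (2 * p)) (diagPow τ (∑ j, p j)) =
      ∏ j, (τ j ^ p j / (p j)!) := by
  classical
  rw [diagPow_eq_sum, coeff_sum, Finset.sum_eq_single p]
  · simp
  · intro q _ hq
    rw [coeff_monomial, if_neg]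
    intro h
    refine hq (funext fun j => ?_)
    have := congrFun (Finsupp.equivFunOnFinite.symm.injective h) j
    simpa using this
  · intro h
    exact absurd (Finset.mem_piAntidiag.2 ⟨rfl, by simp⟩) h

lemma bombieriSq_diagPow [DecidableEq σ] (τ : σ → ℂ) (d : ℕ) :
    bombieriSq (diagPow τ d) = ∑ p ∈ Finset.univ.piAntidiag d,
      ∏ j, (((2 * p j)! : ℝ) * (‖τ j‖ ^ p j / (p j)!) ^ 2) := by
  rw [← Complex.ofReal_inj, ← fischer_conj]
  nth_rw 1 [diagPow_eq_sum]
  rw [fischer_sum_left]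
  push_cast
  refine Finset.sum_congr rfl fun p hp => ?_
  have hd : ∑ j, p j = d := (Finset.mem_piAntidiag.1 hp).1
  subst hd
  rw [fischer_monomial_left, coeff_map, coeff_diagPow, mul_assoc, Complex.mul_conj', norm_prod,
    Finset.prod_mul_distrib]
  simp [Finset.prod_pow]

lemma factorial_two_mul_le (p : ℕ) : ((2 * p)! : ℝ) ≤ 4 ^ p * (p ! : ℝ) ^ 2 := by
  have h₁ : (2 * p).choose p ≤ 2 ^ (2 * p) := Nat.choose_le_two_pow _ _
  have h₂ := Nat.choose_mul_factorial_mul_factorial (show p ≤ 2 * p by omega)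
  rw [show 2 * p - p = p by omega] at h₂
  have h₃ : (2 * p)! ≤ 4 ^ p * p ! ^ 2 := by
    rw [← h₂, mul_assoc, ← sq, show 4 = 2 ^ 2 by rfl, ← pow_mul]
    exact Nat.mul_le_mul_right _ h₁
  exact_mod_cast h₃

lemma sum_bombieriSq_diagPow_le {τ : σ → ℂ} (hτ : ∀ j, (2 * ‖τ j‖) ^ 2 < 1) (M : ℕ) :
    ∑ d ∈ Finset.range M, bombieriSq (diagPow τ d) ≤ ∏ j, (1 - (2 * ‖τ j‖) ^ 2)⁻¹ := by
  classical
  have hle : ∀ p : σ → ℕ, ∏ j, (((2 * p j)! : ℝ) * (‖τ j‖ ^ p j / (p j)!) ^ 2) ≤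
      ∏ j, ((2 * ‖τ j‖) ^ 2) ^ p j := by
    intro p
    refine Finset.prod_le_prod (fun j _ => by positivity) fun j _ => ?_
    have := factorial_two_mul_le (p j)
    calc ((2 * p j)! : ℝ) * (‖τ j‖ ^ p j / (p j)!) ^ 2
        ≤ (4 ^ p j * ((p j)! : ℝ) ^ 2) * (‖τ j‖ ^ p j / (p j)!) ^ 2 := by gcongr
      _ = ((2 * ‖τ j‖) ^ 2) ^ p j := by
        have : ((p j)! : ℝ) ≠ 0 := by positivity
        field_simp
        rw [mul_pow, ← pow_mul, mul_comm (p j) 2, pow_mul]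
        norm_num
  calc ∑ d ∈ Finset.range M, bombieriSq (diagPow τ d)
      ≤ ∑ d ∈ Finset.range M, ∑ p ∈ Finset.univ.piAntidiag d, ∏ j, ((2 * ‖τ j‖) ^ 2) ^ p j := by
        refine Finset.sum_le_sum fun d _ => ?_
        rw [bombieriSq_diagPow]
        exact Finset.sum_le_sum fun p _ => hle p
    _ = ∑ p ∈ (Finset.range M).biUnion fun d => (Finset.univ : Finset σ).piAntidiag d,
          ∏ j, ((2 * ‖τ j‖) ^ 2) ^ p j := by
        rw [Finset.sum_biUnion]
        intro d _ e _ hde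
        refine Finset.disjoint_left.2 fun p hp hp' => hde ?_
        rw [← (Finset.mem_piAntidiag.1 hp).1, ← (Finset.mem_piAntidiag.1 hp').1]
    _ ≤ ∑ p ∈ Fintype.piFinset fun _ : σ => Finset.range M, ∏ j, ((2 * ‖τ j‖) ^ 2) ^ p j := by
        refine Finset.sum_le_sum_of_subset_of_nonneg (fun p hp => ?_)
          fun p _ _ => Finset.prod_nonneg fun j _ => by positivity
        obtain ⟨d, hd, hp⟩ := Finset.mem_biUnion.1 hp
        rw [Fintype.mem_piFinset]
        intro j
        have h₁ : p j ≤ ∑ i, p i := Finset.single_le_sum (fun _ _ => Nat.zero_le _) (Finset.mem_univ j)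
        have h₂ : ∑ i, p i = d := (Finset.mem_piAntidiag.1 hp).1
        simp only [Finset.mem_range] at hd ⊢
        omega
    _ = ∏ j, ∑ k ∈ Finset.range M, ((2 * ‖τ j‖) ^ 2) ^ k := by rw [Finset.prod_univ_sum]
    _ ≤ ∏ j, (1 - (2 * ‖τ j‖) ^ 2)⁻¹ := by
        refine Finset.prod_le_prod (fun j _ => Finset.sum_nonneg fun k _ => by positivity)
          fun j _ => ?_
        rw [← tsum_geometric_of_lt_one (by positivity) (hτ j)]
        exact (summable_geometric_of_lt_one (by positivity) (hτ j)).sum_le_tsum _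
          fun k _ => by positivity

/-- The coefficients of `exp (∑ⱼ τⱼ (∑ᵢ Uᵢⱼ zᵢ)²)`. -/
def gaussCoeff (U : Matrix σ σ ℂ) (τ : σ → ℂ) (n : σ → ℕ) : ℂ :=
  coeff (Finsupp.equivFunOnFinite.symm n) (linSubst U (diagPow τ ((∑ i, n i) / 2)))

lemma summable_gaussCoeff [DecidableEq σ] {U : Matrix σ σ ℂ} (hU : U ∈ Matrix.unitaryGroup σ ℂ)
    {τ : σ → ℂ} (hτ : ∀ j, (2 * ‖τ j‖) ^ 2 < 1) :
    Summable fun n : σ → ℕ => (∏ i, ((n i)! : ℝ)) * ‖gaussCoeff U τ n‖ ^ 2 := by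
  refine summable_of_sum_le (c := ∏ j, (1 - (2 * ‖τ j‖) ^ 2)⁻¹) (fun n => by positivity)
    fun F => ?_
  obtain ⟨M, hM⟩ : ∃ M, ∀ n ∈ F, (∑ i, n i) / 2 ∈ Finset.range M :=
    ⟨F.sup (fun n => (∑ i, n i) / 2) + 1, fun n hn => Finset.mem_range.2
      (Nat.lt_succ_of_le (Finset.le_sup (f := fun n : σ → ℕ => (∑ i, n i) / 2) hn))⟩
  rw [← Finset.sum_fiberwise_of_maps_to hM]
  refine le_trans (Finset.sum_le_sum fun d _ => ?_) (sum_bombieriSq_diagPow_le hτ M)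
  rw [← bombieriSq_linSubst hU]
  refine le_trans (Finset.sum_le_sum fun n hn => ?_)
    (sum_le_bombieriSq _ {n ∈ F | (∑ i, n i) / 2 = d})
  rw [gaussCoeff, (Finset.mem_filter.1 hn).2]

end Fischer

/-! ### Contraction of diagrams -/

lemma tensor_fock_singleton {E : Type} (ℓ : E → ℕ) (g : ℕ → ℂ) (e : E) :
    Generator.tensor ℓ (.fock g {e}) = g (ℓ e) := by
  simp only [Generator.tensor, Multiset.mem_singleton, forall_eq]
  rw [tsum_eq_single (ℓ e) fun n hn => if_neg hn.symm, if_pos rfl]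

lemma tensor_fock_pair {E : Type} (ℓ : E → ℕ) (g : ℕ → ℂ) (e f : E) :
    Generator.tensor ℓ (.fock g {e, f}) = if ℓ e = ℓ f then g (ℓ e) else 0 := by
  simp only [Generator.tensor, Multiset.insert_eq_cons, Multiset.mem_cons,
    Multiset.mem_singleton, forall_eq_or_imp, forall_eq]
  rw [tsum_eq_single (ℓ e) fun n hn => if_neg fun h => hn h.1.symm]
  simp [eq_comm]

/-- If the weight vanishes outside the image of an injective family of labellings indexed by a
finite set, the contraction is a finite sum. -/
lemma summable_and_amplitude_eq {E : Type} [Fintype E] {s : ℕ} (D : Diagram E s) (n : Fin s → ℕ)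
    {κ : Type} (K : Finset κ) (f : κ → E → ℕ) (hf : ∀ k ∈ K, ∀ i, f k (D.out i) = n i)
    (hinj : Function.Injective f)
    (hsupp : ∀ ℓ : E → ℕ, (∀ i, ℓ (D.out i) = n i) → D.weight ℓ ≠ 0 → ∃ k ∈ K, f k = ℓ) :
    (Summable fun ℓ : D.Labelling n => D.weight ℓ.1) ∧
      D.amplitude n = D.scalar * ∑ k ∈ K, D.weight (f k) := by
  let g : {k // k ∈ K} → D.Labelling n := fun k => ⟨f k, hf k k.2⟩
  have hg : Function.Injective g := fun k l h =>
    Subtype.ext (hinj (congrArg Subtype.val h))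
  have hs : Function.support (fun ℓ : D.Labelling n => D.weight ℓ.1) ⊆ Set.range g := by
    intro ℓ hℓ
    obtain ⟨k, hk, h⟩ := hsupp ℓ.1 ℓ.2 hℓ
    exact ⟨⟨k, hk⟩, Subtype.ext h⟩
  refine ⟨(hg.summable_iff fun ℓ hℓ => ?_).1 (hasSum_fintype _).summable, ?_⟩
  · by_contra h
    exact hℓ (hs h)
  · rw [Diagram.amplitude, ← hg.tsum_eq hs, ← Finset.tsum_subtype]

/-! ### The coefficients of the circuit -/

variable {s : ℕ}

/-- The labelling of the circuit with `k j i` photons on the edge from input `j` to output `i`. -/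
def circuitLabel (k : Fin s → Fin s → ℕ) : CircuitWire s → ℕ
  | .vac _ => 0
  | .inp j => ∑ i, k j i
  | .left j i => k j i
  | .right j i => k j i
  | .out i => ∑ j, k j i

/-- The matrices of photon numbers with column sums `n`. -/
def columnMatrices (n : Fin s → ℕ) : Finset (Fin s → Fin s → ℕ) :=
  {k ∈ Fintype.piFinset fun _ => Fintype.piFinset fun i => Finset.range (n i + 1) |
    ∀ i, ∑ j, k j i = n i}

lemma mem_columnMatrices {n : Fin s → ℕ} {k : Fin s → Fin s → ℕ} :
    k ∈ columnMatrices n ↔ ∀ i, ∑ j, k j i = n i := by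
  simp only [columnMatrices, Finset.mem_filter, Fintype.mem_piFinset, Finset.mem_range,
    and_iff_right_iff_imp]
  intro h j i
  rw [← h i, Nat.lt_succ_iff]
  exact Finset.single_le_sum (f := fun j => k j i) (fun _ _ => Nat.zero_le _) (Finset.mem_univ j)

lemma circuit_weight (U : Matrix (Fin s) (Fin s) ℂ) (r : Fin s → ℝ) (ℓ : CircuitWire s → ℕ) :
    (gbsCircuit U r).weight ℓ =
      (∏ j, if ℓ (.vac j) = 0 then 1 else 0) *
      (∏ j, ((∫ x : ℝ, hermiteFun (ℓ (.inp j)) (Real.exp (-r j) * x) *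
        hermiteFun (ℓ (.vac j)) x : ℝ) : ℂ)) *
      (∏ j, if ℓ (.inp j) = ∑ i, ℓ (.left j i) then
        ((√(((ℓ (.inp j))! : ℝ) / ∏ i, ((ℓ (.left j i))! : ℝ)) : ℝ) : ℂ) else 0) *
      (∏ p : Fin s × Fin s, if ℓ (.left p.1 p.2) = ℓ (.right p.1 p.2) then
        U p.2 p.1 ^ ℓ (.left p.1 p.2) else 0) *
      (∏ i, if ℓ (.out i) = ∑ j, ℓ (.right j i) then
        ((√(((ℓ (.out i))! : ℝ) / ∏ j, ((ℓ (.right j i))! : ℝ)) : ℝ) : ℂ) else 0) := by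
  simp only [Diagram.weight, gbsCircuit, circuitNodes, Multiset.map_add, Multiset.prod_add,
    Multiset.map_map, Function.comp_def, tensor_fock_singleton, tensor_fock_pair]
  simp only [Generator.tensor, Multiset.map_map, Function.comp_def]
  rfl

lemma circuit_label_of_weight_ne_zero (U : Matrix (Fin s) (Fin s) ℂ) (r : Fin s → ℝ)
    (ℓ : CircuitWire s → ℕ) (h : (gbsCircuit U r).weight ℓ ≠ 0) :
    ℓ = circuitLabel fun j i => ℓ (.left j i) := by
  simp only [circuit_weight, mul_ne_zero_iff, Finset.prod_ne_zero_iff, Finset.mem_univ,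
    forall_true_left, ite_ne_right_iff] at h
  obtain ⟨⟨⟨⟨h₁, -⟩, h₃⟩, h₄⟩, h₅⟩ := h
  funext e
  cases e with
  | vac j => exact (h₁ j).1
  | inp j => exact (h₃ j).1
  | left j i => rfl
  | right j i => exact (h₄ (j, i)).1.symm
  | out i =>
    rw [(h₅ i).1]
    exact Finset.sum_congr rfl fun j _ => (h₄ (j, i)).1.symm

/-- The contribution of a matrix of photon numbers to a Gaussian coefficient. -/
def matrixTerm (U : Matrix (Fin s) (Fin s) ℂ) (τ : Fin s → ℂ) (k : Fin s → Fin s → ℕ) : ℂ :=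
  ∏ j, ((if Even (∑ i, k j i) then
      ((∑ i, k j i)! : ℂ) * (τ j ^ ((∑ i, k j i) / 2) / (((∑ i, k j i) / 2)! : ℂ)) else 0) *
    ∏ i, (U i j ^ k j i / ((k j i)! : ℂ)))

lemma prod_sqrt_factorial_mul (k : Fin s → Fin s → ℕ) :
    (∏ j, √(∏ i, ((k j i)! : ℝ))) * (∏ i, √(∏ j, ((k j i)! : ℝ))) = ∏ j, ∏ i, ((k j i)! : ℝ) := by
  have h : ∀ f : Fin s → ℕ, √(∏ i, ((f i)! : ℝ)) = ∏ i, √((f i)! : ℝ) := fun f =>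
    Real.sqrt_prod _ fun i _ => by positivity
  simp only [h]
  rw [Finset.prod_comm (f := fun i j => √((k j i)! : ℝ)), ← Finset.prod_mul_distrib]
  refine Finset.prod_congr rfl fun j _ => ?_
  rw [← Finset.prod_mul_distrib]
  exact Finset.prod_congr rfl fun i _ => Real.mul_self_sqrt (by positivity)

lemma circuit_scalar_mul_weight (U : Matrix (Fin s) (Fin s) ℂ) (r : Fin s → ℝ)
    (k : Fin s → Fin s → ℕ) :
    (gbsCircuit U r).scalar * (gbsCircuit U r).weight (circuitLabel k) =
      (∏ i, ((1 / √(Real.cosh (r i)) : ℝ) : ℂ)) * (√(∏ i, ((∑ j, k j i)! : ℝ)) : ℝ) *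
        matrixTerm U (fun j => -(Real.tanh (r j) / 2 : ℝ)) k := by
  have hq := fun j => squeezed_vacuum_coeff (r j) (∑ i, k j i)
  have hk : ((∏ j, √(∏ i, ((k j i)! : ℝ)) : ℝ) : ℂ) * ((∏ i, √(∏ j, ((k j i)! : ℝ)) : ℝ) : ℂ) =
      ∏ j, ∏ i, ((k j i)! : ℂ) := by
    rw [← Complex.ofReal_mul, prod_sqrt_factorial_mul]
    push_cast
    rfl
  have hl : (∏ j, (((√(((∑ i, k j i)! : ℝ) / ∏ i, ((k j i)! : ℝ)) : ℝ) : ℂ))) =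
      (∏ j, (√((∑ i, k j i)! : ℝ) : ℂ)) / ((∏ j, √(∏ i, ((k j i)! : ℝ)) : ℝ) : ℂ) := by
    push_cast
    rw [← Finset.prod_div_distrib]
    refine Finset.prod_congr rfl fun j _ => ?_
    rw [Real.sqrt_div (by positivity)]
    push_cast
    rfl
  have hr : (∏ i, (((√(((∑ j, k j i)! : ℝ) / ∏ j, ((k j i)! : ℝ)) : ℝ) : ℂ))) =
      ((√(∏ i, ((∑ j, k j i)! : ℝ)) : ℝ) : ℂ) / ((∏ i, √(∏ j, ((k j i)! : ℝ)) : ℝ) : ℂ) := by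
    rw [Real.sqrt_prod _ fun i _ => by positivity]
    push_cast
    rw [← Finset.prod_div_distrib]
    refine Finset.prod_congr rfl fun j _ => ?_
    rw [Real.sqrt_div (by positivity)]
    push_cast
    rfl
  have hm : (∏ j, (Real.exp (-r j / 2) : ℂ)) *
      (∏ j, ((∫ x : ℝ, hermiteFun (∑ i, k j i) (Real.exp (-r j) * x) *
        hermiteFun 0 x : ℝ) : ℂ)) * (∏ j, (√((∑ i, k j i)! : ℝ) : ℂ)) =
      (∏ i, ((1 / √(Real.cosh (r i)) : ℝ) : ℂ)) * ∏ j, (if Even (∑ i, k j i) then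
        ((∑ i, k j i)! : ℂ) * ((-(Real.tanh (r j) / 2 : ℝ) : ℂ) ^ ((∑ i, k j i) / 2) /
          (((∑ i, k j i) / 2)! : ℂ)) else 0) := by
    simp only [← Finset.prod_mul_distrib]
    refine Finset.prod_congr rfl fun j _ => ?_
    rw [← Complex.ofReal_mul, hq, ← Complex.ofReal_mul, mul_assoc]
    split_ifs
    · rw [mul_right_comm, Real.mul_self_sqrt (by positivity)]
      push_cast
      rfl
    · simp
  simp only [circuit_weight, circuitLabel, if_true, Finset.prod_const_one, one_mul]
  rw [hl, hr, Fintype.prod_prod_type, matrixTerm, Finset.prod_mul_distrib]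
  have hu : ∏ j, ∏ i, (U i j ^ k j i / ((k j i)! : ℂ)) =
      (∏ j, ∏ i, U i j ^ k j i) / ∏ j, ∏ i, ((k j i)! : ℂ) := by
    simp only [Finset.prod_div_distrib]
  have hsc : (gbsCircuit U r).scalar = ∏ j, (Real.exp (-r j / 2) : ℂ) := rfl
  rw [hu, ← hk, hsc]
  linear_combination ((√(∏ i, ((∑ j, k j i)! : ℝ)) : ℝ) * (∏ j, ∏ i, U i j ^ k j i) /
    (((∏ j, √(∏ i, ((k j i)! : ℝ)) : ℝ) : ℂ) * ((∏ i, √(∏ j, ((k j i)! : ℝ)) : ℝ) : ℂ)) : ℂ) * hm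

lemma linSubst_X_pow (U : Matrix (Fin s) (Fin s) ℂ) (j : Fin s) (N : ℕ) :
    linSubst U (X j) ^ N = ∑ k ∈ Finset.univ.piAntidiag N,
      monomial (Finsupp.equivFunOnFinite.symm k) ((N ! : ℂ) * ∏ i, (U i j ^ k i / ((k i)! : ℂ))) := by
  have h := divided_pow_sum (fun i => C (U i j) * X i) (A := MvPolynomial (Fin s) ℂ) N
  have hN : (N ! : ℂ) ≠ 0 := Nat.cast_ne_zero.2 (Nat.factorial_ne_zero N)
  replace h := congrArg (C (N ! : ℂ) * ·) h
  simp only [algebraMap_eq, ← mul_assoc, ← C_mul, mul_inv_cancel₀ hN, C_1, one_mul] at h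
  rw [linSubst_X, h, Finset.mul_sum]
  refine Finset.sum_congr rfl fun k _ => ?_
  rw [monomial_eq, C_mul, mul_assoc, map_prod, Finsupp.prod_fintype _ _ (by simp),
    ← Finset.prod_mul_distrib]
  congr 1
  refine Finset.prod_congr rfl fun i _ => ?_
  simp only [mul_pow, Finsupp.equivFunOnFinite_symm_apply_apply, div_eq_mul_inv, map_mul, map_pow]
  ring

lemma coeff_prod_linSubst_X_pow (U : Matrix (Fin s) (Fin s) ℂ) (N n : Fin s → ℕ) :
    coeff (Finsupp.equivFunOnFinite.symm n) (∏ j, linSubst U (X j) ^ N j) =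
      ∑ k ∈ columnMatrices n with ∀ j, ∑ i, k j i = N j,
        ∏ j, (((N j)! : ℂ) * ∏ i, (U i j ^ k j i / ((k j i)! : ℂ))) := by
  simp only [linSubst_X_pow, Finset.prod_univ_sum, coeff_sum, ← monomial_sum_prod, coeff_monomial]
  rw [← Finset.sum_filter]
  refine Finset.sum_congr (Finset.ext fun k => ?_) fun _ _ => rfl
  simp only [Finset.mem_filter, Fintype.mem_piFinset, mem_columnMatrices, Finset.mem_piAntidiag,
    Finset.mem_univ, implies_true, and_true, Finsupp.ext_iff, Finsupp.coe_finsetSum,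
    Finset.sum_apply, Finsupp.equivFunOnFinite_symm_apply_apply]
  exact and_comm

lemma linSubst_diagPow (U : Matrix (Fin s) (Fin s) ℂ) (τ : Fin s → ℂ) (d : ℕ) :
    linSubst U (diagPow τ d) = ∑ p ∈ Finset.univ.piAntidiag d,
      C (∏ j, (τ j ^ p j / ((p j)! : ℂ))) * ∏ j, linSubst U (X j) ^ (2 * p j) := by
  rw [diagPow_eq_sum, map_sum]
  refine Finset.sum_congr rfl fun p _ => ?_
  rw [monomial_eq, Finsupp.prod_fintype _ _ (by simp), map_mul, linSubst_C,
    map_prod (linSubst U)]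
  simp

lemma sum_matrixTerm (U : Matrix (Fin s) (Fin s) ℂ) (τ : Fin s → ℂ) (n : Fin s → ℕ) :
    ∑ k ∈ columnMatrices n, matrixTerm U τ k = gaussCoeff U τ n := by
  have heven : ∑ k ∈ columnMatrices n with ∀ j, Even (∑ i, k j i), matrixTerm U τ k =
      ∑ k ∈ columnMatrices n, matrixTerm U τ k := by
    refine Finset.sum_filter_of_ne fun k _ hk j => ?_
    by_contra h
    exact hk (Finset.prod_eq_zero (Finset.mem_univ j) (by rw [if_neg h, zero_mul]))
  have hmaps : ∀ k ∈ {k ∈ columnMatrices n | ∀ j, Even (∑ i, k j i)},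
      (fun j => (∑ i, k j i) / 2) ∈ Finset.univ.piAntidiag ((∑ i, n i) / 2) := by
    intro k hk
    obtain ⟨hk, he⟩ := Finset.mem_filter.1 hk
    rw [mem_columnMatrices] at hk
    refine Finset.mem_piAntidiag.2 ⟨?_, by simp⟩
    have h : ∑ i, n i = 2 * ∑ j, (∑ i, k j i) / 2 := by
      simp only [← hk]
      rw [Finset.sum_comm, Finset.mul_sum]
      exact Finset.sum_congr rfl fun j _ => (Nat.two_mul_div_two_of_even (he j)).symm
    rw [h]
    exact (Nat.mul_div_cancel_left _ two_pos).symm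
  rw [← heven, ← Finset.sum_fiberwise_of_maps_to hmaps, gaussCoeff, linSubst_diagPow, coeff_sum]
  refine Finset.sum_congr rfl fun p _ => ?_
  rw [coeff_C_mul, coeff_prod_linSubst_X_pow, Finset.mul_sum, Finset.filter_filter]
  refine Finset.sum_congr (Finset.filter_congr fun k _ => ?_) fun k hk => ?_
  · constructor
    · rintro ⟨h, rfl⟩ j
      exact (Nat.two_mul_div_two_of_even (h j)).symm
    · intro h
      exact ⟨fun j => ⟨p j, by rw [h j, two_mul]⟩, funext fun j => by rw [h j]; omega⟩
  · have h := (Finset.mem_filter.1 hk).2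
    rw [matrixTerm, ← Finset.prod_mul_distrib]
    refine Finset.prod_congr rfl fun j _ => ?_
    rw [h j, if_pos (even_two_mul _), Nat.mul_div_cancel_left _ two_pos]
    ring

/-- The contractions of the circuit converge, and its coefficients are Gaussian. -/
lemma circuit_summable_and_amplitude (U : Matrix (Fin s) (Fin s) ℂ) (r : Fin s → ℝ)
    (n : Fin s → ℕ) :
    (Summable fun ℓ : (gbsCircuit U r).Labelling n => (gbsCircuit U r).weight ℓ.1) ∧
      (gbsCircuit U r).amplitude n =
        (∏ i, ((1 / √(Real.cosh (r i)) : ℝ) : ℂ)) * (√(∏ i, ((n i)! : ℝ)) : ℝ) *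
          gaussCoeff U (fun j => -(Real.tanh (r j) / 2 : ℝ)) n := by
  have h := summable_and_amplitude_eq (gbsCircuit U r) n (columnMatrices n) circuitLabel
    (fun k hk i => mem_columnMatrices.1 hk i)
    (fun k l h => funext fun j => funext fun i => congrFun h (.left j i))
    (fun ℓ hℓ hw => ⟨_, mem_columnMatrices.2 fun i => ?_,
      (circuit_label_of_weight_ne_zero U r ℓ hw).symm⟩)
  · refine ⟨h.1, h.2.trans ?_⟩
    rw [Finset.mul_sum, ← sum_matrixTerm, Finset.mul_sum]
    refine Finset.sum_congr rfl fun k hk => ?_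
    rw [circuit_scalar_mul_weight]
    simp only [mem_columnMatrices.1 hk]
  · exact (congrFun (circuit_label_of_weight_ne_zero U r ℓ hw) (.out i)).symm.trans (hℓ i)

/-! ### The coefficients of the normal form -/

@[to_additive]
lemma prod_prod_ne_eq_prod_lt {M : Type*} [CommMonoid M] (f : ∀ i j : Fin s, i ≠ j → M) :
    ∏ i, ∏ j : {j : Fin s // i ≠ j}, f i j.1 j.2 =
      ∏ p : {p : Fin s × Fin s // p.1 < p.2},
        (f p.1.1 p.1.2 p.2.ne * f p.1.2 p.1.1 p.2.ne') := by
  classical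
  let g : Fin s → Fin s → M := fun i j => if h : i ≠ j then f i j h else 1
  have hg : ∀ i j (h : i ≠ j), g i j = f i j h := fun i j h => dif_pos h
  have h₁ : ∀ i, ∏ j : {j : Fin s // i ≠ j}, f i j.1 j.2 = ∏ j, g i j := by
    intro i
    rw [← Fintype.prod_subtype_mul_prod_subtype (fun j => i ≠ j) (g i)]
    rw [Fintype.prod_congr (fun j : {j : Fin s // i ≠ j} => f i j.1 j.2) (fun j => g i j.1)
      fun j => (hg i j.1 j.2).symm]
    refine (mul_one _).symm.trans (congrArg _ (Finset.prod_eq_one fun j _ => ?_).symm)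
    exact dif_neg j.2
  have h₂ : ∏ p : {p : Fin s × Fin s // p.1 < p.2},
      (f p.1.1 p.1.2 p.2.ne * f p.1.2 p.1.1 p.2.ne') =
      ∏ i, ∏ j, if i < j then g i j * g j i else 1 := by
    rw [← Fintype.prod_prod_type' (f := fun i j => if i < j then g i j * g j i else 1),
      ← Finset.prod_filter, Finset.prod_subtype (p := fun p : Fin s × Fin s => p.1 < p.2) _
        (by simp)]
    exact Fintype.prod_congr _ _ fun p => by rw [hg _ _ p.2.ne, hg _ _ p.2.ne']
  have h₃ : ∏ i, ∏ j, (if i < j then g i j * g j i else 1) =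
      (∏ i, ∏ j, if i < j then g i j else 1) * ∏ i, ∏ j, if j < i then g i j else 1 := by
    rw [Finset.prod_comm (f := fun i j => if j < i then g i j else 1)]
    simp only [← Finset.prod_mul_distrib]
    refine Finset.prod_congr rfl fun i _ => Finset.prod_congr rfl fun j _ => ?_
    split_ifs <;> simp
  rw [h₂, h₃, Fintype.prod_congr _ _ h₁]
  simp only [← Finset.prod_mul_distrib]
  refine Finset.prod_congr rfl fun i _ => Finset.prod_congr rfl fun j _ => ?_
  rcases lt_trichotomy i j with h | h | h
  · simp [h, h.not_gt]
  · simp [h, g]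
  · simp [h, h.not_gt]

/-- The edges of the complete graph with self-loops. -/
abbrev GraphEdge (s : ℕ) : Type := {p : Fin s × Fin s // p.1 < p.2} ⊕ Fin s

/-- The exponent of the monomial of an edge. -/
def edgeExponent : GraphEdge s → Fin s →₀ ℕ
  | .inl p => Finsupp.single p.1.1 1 + Finsupp.single p.1.2 1
  | .inr i => Finsupp.single i 2

/-- The edge labels. -/
def edgeLabel (A : Matrix (Fin s) (Fin s) ℂ) (t : Fin s → ℂ) : GraphEdge s → ℂ
  | .inl p => A p.1.1 p.1.2
  | .inr i => t i

/-- The edge joining two distinct W nodes. -/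
def edgeOf (p : {p : Fin s × Fin s // p.1 ≠ p.2}) : {p : Fin s × Fin s // p.1 < p.2} :=
  if h : p.1.1 < p.1.2 then ⟨p.1, h⟩
  else ⟨(p.1.2, p.1.1), lt_of_le_of_ne (not_lt.1 h) p.2.symm⟩

lemma edgeOf_of_lt (p : {p : Fin s × Fin s // p.1 < p.2}) :
    edgeOf ⟨(p.1.1, p.1.2), p.2.ne⟩ = p :=
  dif_pos p.2

lemma edgeOf_of_gt (p : {p : Fin s × Fin s // p.1 < p.2}) :
    edgeOf ⟨(p.1.2, p.1.1), p.2.ne'⟩ = p :=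
  dif_neg p.2.not_gt

/-- The labelling of the complete graph with `k e` photons on the edge `e`. -/
def graphLabel (k : GraphEdge s → ℕ) : GraphWire s → ℕ
  | .out i => (∑ e, k e • edgeExponent e) i
  | .half p => k (.inl (edgeOf p))
  | .loop i _ => k (.inr i)

lemma sum_edgeExponent_apply (k : GraphEdge s → ℕ) (i : Fin s) :
    (∑ e, k e • edgeExponent e) i =
      ∑ j : {j : Fin s // i ≠ j}, k (.inl (edgeOf ⟨(i, j.1), j.2⟩)) +
        (k (.inr i) + k (.inr i)) := by
  classical
  have h := sum_sum_ne_eq_sum_lt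
    (fun a b (hab : a ≠ b) => if a = i then k (.inl (edgeOf ⟨(a, b), hab⟩)) else 0)
  rw [Finset.sum_eq_single i (fun a _ ha => by simp [ha]) (by simp)] at h
  simp only [if_true] at h
  rw [h, Finsupp.finsetSum_apply, Fintype.sum_sum_type]
  simp only [edgeOf_of_lt, edgeOf_of_gt]
  congr 1
  · refine Finset.sum_congr rfl fun p _ => ?_
    simp [edgeExponent, Finsupp.single_apply]
  · simp [edgeExponent, Finsupp.single_apply]
    ring

/-- The photon numbers on the edges that give `n` photons on the outputs. -/
def edgeNumbers (n : Fin s → ℕ) : Finset (GraphEdge s → ℕ) :=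
  {k ∈ Finset.univ.piAntidiag ((∑ i, n i) / 2) |
    ∑ e, k e • edgeExponent e = Finsupp.equivFunOnFinite.symm n}

lemma sum_edgeExponent (e : GraphEdge s) : ∑ i, edgeExponent e i = 2 := by
  cases e with
  | inl p => simp [edgeExponent, Finset.sum_add_distrib]
  | inr i => simp [edgeExponent]

lemma mem_edgeNumbers {n : Fin s → ℕ} {k : GraphEdge s → ℕ} :
    k ∈ edgeNumbers n ↔ ∀ i, (∑ e, k e • edgeExponent e) i = n i := by
  simp only [edgeNumbers, Finset.mem_filter, Finsupp.ext_iff,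
    Finsupp.equivFunOnFinite_symm_apply_apply, and_iff_right_iff_imp]
  intro h
  refine Finset.mem_piAntidiag.2 ⟨?_, by simp⟩
  have h₂ : ∑ i, n i = 2 * ∑ e, k e := by
    simp only [← h, Finsupp.finsetSum_apply, Finsupp.smul_apply, smul_eq_mul]
    rw [Finset.sum_comm, Finset.mul_sum]
    refine Finset.sum_congr rfl fun e _ => ?_
    rw [← Finset.mul_sum, sum_edgeExponent, mul_comm]
  rw [h₂, Nat.mul_div_cancel_left _ two_pos]

lemma graph_weight (A : Matrix (Fin s) (Fin s) ℂ) (t : Fin s → ℂ) (c : ℂ) (ℓ : GraphWire s → ℕ) :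
    (graphDiagram A t c).weight ℓ =
      (∏ i, if ℓ (.out i) = ∑ j : {j : Fin s // i ≠ j}, ℓ (.half ⟨(i, j.1), j.2⟩) +
          (ℓ (.loop i false) + ℓ (.loop i true)) then
        ((√(((ℓ (.out i))! : ℝ) / ((∏ j : {j : Fin s // i ≠ j},
          ((ℓ (.half ⟨(i, j.1), j.2⟩))! : ℝ)) *
            (((ℓ (.loop i false))! : ℝ) * ((ℓ (.loop i true))! : ℝ)))) : ℝ) : ℂ) else 0) *
      (∏ p : {p : Fin s × Fin s // p.1 < p.2},
        if ℓ (.half ⟨(p.1.1, p.1.2), p.2.ne⟩) = ℓ (.half ⟨(p.1.2, p.1.1), p.2.ne'⟩) then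
          A p.1.1 p.1.2 ^ ℓ (.half ⟨(p.1.1, p.1.2), p.2.ne⟩) else 0) *
      (∏ i, if ℓ (.loop i false) = ℓ (.loop i true) then t i ^ ℓ (.loop i false) else 0) := by
  simp only [Diagram.weight, graphDiagram, graphNodes, Multiset.map_add, Multiset.prod_add,
    Multiset.map_map, Function.comp_def, tensor_fock_pair]
  simp only [Generator.tensor, Multiset.map_add, Multiset.sum_add, Multiset.prod_add,
    Multiset.map_map, Function.comp_def, Multiset.insert_eq_cons, Multiset.map_cons,
    Multiset.map_singleton, Multiset.sum_cons, Multiset.sum_singleton, Multiset.prod_cons,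
    Multiset.prod_singleton]
  rfl

/-- The photon numbers on the edges of the complete graph. -/
def graphNumbers (ℓ : GraphWire s → ℕ) : GraphEdge s → ℕ
  | .inl p => ℓ (.half ⟨(p.1.1, p.1.2), p.2.ne⟩)
  | .inr i => ℓ (.loop i false)

lemma graph_label_of_weight_ne_zero (A : Matrix (Fin s) (Fin s) ℂ) (t : Fin s → ℂ) (c : ℂ)
    (ℓ : GraphWire s → ℕ) (h : (graphDiagram A t c).weight ℓ ≠ 0) :
    graphLabel (graphNumbers ℓ) = ℓ := by
  simp only [graph_weight, mul_ne_zero_iff, Finset.prod_ne_zero_iff, Finset.mem_univ,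
    forall_true_left, ite_ne_right_iff] at h
  obtain ⟨⟨h₁, h₂⟩, h₃⟩ := h
  have hhalf : ∀ p, graphNumbers ℓ (.inl (edgeOf p)) = ℓ (.half p) := by
    rintro ⟨⟨i, j⟩, hij⟩
    rcases lt_or_gt_of_ne hij with hl | hl
    · exact congrArg (fun p => graphNumbers ℓ (.inl p)) (edgeOf_of_lt ⟨(i, j), hl⟩)
    · exact (congrArg (fun p => graphNumbers ℓ (.inl p)) (edgeOf_of_gt ⟨(j, i), hl⟩)).trans
        (h₂ ⟨(j, i), hl⟩).1
  funext e
  cases e with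
  | half p => exact hhalf p
  | loop i b =>
    cases b with
    | false => rfl
    | true => exact (h₃ i).1
  | out i =>
    rw [(h₁ i).1, ← (h₃ i).1, graphLabel, sum_edgeExponent_apply]
    simp only [hhalf]
    rfl

lemma graph_weight_graphLabel (A : Matrix (Fin s) (Fin s) ℂ) (t : Fin s → ℂ) (c : ℂ)
    (k : GraphEdge s → ℕ) :
    (graphDiagram A t c).weight (graphLabel k) =
      (√(∏ i, (((∑ e, k e • edgeExponent e) i)! : ℝ)) : ℝ) *
        ∏ e, (edgeLabel A t e ^ k e / ((k e)! : ℂ)) := by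
  have hw : (∏ i, √((((∑ e, k e • edgeExponent e) i)! : ℝ) / ((∏ j : {j : Fin s // i ≠ j},
      ((k (.inl (edgeOf ⟨(i, j.1), j.2⟩)))! : ℝ)) *
        (((k (.inr i))! : ℝ) * ((k (.inr i))! : ℝ))))) =
      √(∏ i, (((∑ e, k e • edgeExponent e) i)! : ℝ)) / ∏ e, ((k e)! : ℝ) := by
    have h := prod_prod_ne_eq_prod_lt
      (fun a b (hab : a ≠ b) => √((k (.inl (edgeOf ⟨(a, b), hab⟩)))! : ℝ))
    simp only [edgeOf_of_lt, edgeOf_of_gt] at h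
    rw [Fintype.prod_congr _ _ fun p : {p : Fin s × Fin s // p.1 < p.2} =>
      Real.mul_self_sqrt (Nat.cast_nonneg (k (.inl p))!)] at h
    rw [Real.sqrt_prod _ fun i _ => by positivity, Fintype.prod_sum_type, ← h,
      ← Finset.prod_mul_distrib, ← Finset.prod_div_distrib]
    refine Finset.prod_congr rfl fun i _ => ?_
    rw [Real.sqrt_div (by positivity), Real.sqrt_mul (by positivity),
      Real.sqrt_mul_self (by positivity), Real.sqrt_prod _ fun i _ => by positivity]
  have he : ∏ e, edgeLabel A t e ^ k e =
      (∏ p : {p : Fin s × Fin s // p.1 < p.2}, A p.1.1 p.1.2 ^ k (.inl p)) *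
        ∏ i, t i ^ k (.inr i) := Fintype.prod_sum_type _
  simp only [graph_weight, graphLabel, edgeOf_of_lt, edgeOf_of_gt, if_true]
  simp only [← sum_edgeExponent_apply, if_true]
  rw [← Complex.ofReal_prod, hw, Finset.prod_div_distrib, he]
  push_cast
  ring

lemma linSubst_diag (U : Matrix (Fin s) (Fin s) ℂ) (r : Fin s → ℝ) :
    linSubst U (∑ j, C (-(Real.tanh (r j) / 2 : ℝ) : ℂ) * X j ^ 2) =
      ∑ e, monomial (edgeExponent e) (edgeLabel (edgeMatrix U r) (loopLabel U r) e) := by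
  classical
  let τ : Fin s → ℂ := fun j => (-(Real.tanh (r j) / 2 : ℝ) : ℂ)
  let B : Fin s → Fin s → ℂ := fun i k => ∑ j, τ j * (U i j * U k j)
  have h₁ : linSubst U (∑ j, C (τ j) * X j ^ 2) = ∑ i, ∑ k, C (B i k) * (X i * X k) := by
    simp only [map_sum, map_mul, linSubst_C, linSubst_X, sq, B,
      Finset.mul_sum, Finset.sum_mul]
    rw [Finset.sum_comm]
    refine Finset.sum_congr rfl fun i _ => ?_
    rw [Finset.sum_comm]
    exact Finset.sum_congr rfl fun k _ => Finset.sum_congr rfl fun j _ => by ring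
  have h₂ : ∀ i, ∑ k, C (B i k) * (X i * X k) =
      ∑ k : {k : Fin s // i ≠ k}, C (B i k) * (X i * X k.1) +
        (C (B i i) * (X i * X i) : MvPolynomial (Fin s) ℂ) := by
    intro i
    rw [← Finset.sum_erase_add _ _ (Finset.mem_univ i)]
    congr 1
    exact Finset.sum_subtype _ (by simp [eq_comm]) _
  have hsymm : ∀ i k, B k i = B i k := fun i k =>
    Finset.sum_congr rfl fun j _ => by ring
  refine h₁.trans ?_
  rw [Fintype.sum_congr _ _ h₂, Finset.sum_add_distrib,
    sum_sum_ne_eq_sum_lt (fun i k _ => (C (B i k) * (X i * X k) : MvPolynomial (Fin s) ℂ)),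
    Fintype.sum_sum_type]
  congr 1
  · refine Finset.sum_congr rfl fun p _ => ?_
    have hA : edgeMatrix U r p.1.1 p.1.2 = B p.1.1 p.1.2 + B p.1.1 p.1.2 := by
      simp only [edgeMatrix, Matrix.neg_apply, Matrix.mul_apply (N := Uᵀ), Matrix.mul_diagonal,
        Matrix.transpose_apply, B, τ, ← Finset.sum_add_distrib, ← Finset.sum_neg_distrib]
      refine Finset.sum_congr rfl fun j _ => ?_
      push_cast
      ring
    have hm : (X p.1.1 * X p.1.2 : MvPolynomial (Fin s) ℂ) =
        monomial (edgeExponent (.inl p)) 1 := by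
      simp [edgeExponent, X, monomial_mul]
    rw [hsymm p.1.1, mul_comm (X p.1.2), ← add_mul, ← C_add, ← hA, hm, C_mul_monomial, mul_one]
    rfl
  · refine Finset.sum_congr rfl fun i _ => ?_
    have hT : loopLabel U r i = B i i := by
      simp only [loopLabel, B, τ, Finset.mul_sum]
      refine Finset.sum_congr rfl fun j _ => ?_
      push_cast
      ring
    have hm : (X i * X i : MvPolynomial (Fin s) ℂ) = monomial (edgeExponent (.inr i)) 1 := by
      rw [← sq, X_pow_eq_monomial]
      rfl
    rw [← hT, hm, C_mul_monomial, mul_one]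
    rfl

lemma gaussCoeff_eq_sum_edgeNumbers (U : Matrix (Fin s) (Fin s) ℂ) (r : Fin s → ℝ)
    (n : Fin s → ℕ) :
    gaussCoeff U (fun j => -(Real.tanh (r j) / 2 : ℝ)) n =
      ∑ k ∈ edgeNumbers n,
        ∏ e, (edgeLabel (edgeMatrix U r) (loopLabel U r) e ^ k e / ((k e)! : ℂ)) := by
  have h := divided_pow_sum (A := MvPolynomial (Fin s) ℂ) (fun e : GraphEdge s =>
    monomial (edgeExponent e) (edgeLabel (edgeMatrix U r) (loopLabel U r) e)) ((∑ i, n i) / 2)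
  simp only [algebraMap_eq, monomial_pow, C_mul_monomial, ← monomial_sum_prod] at h
  rw [gaussCoeff, diagPow, map_mul, map_pow, linSubst_diag, linSubst_C, h, coeff_sum]
  simp only [coeff_monomial]
  rw [← Finset.sum_filter]
  refine Finset.sum_congr rfl fun k _ => Finset.prod_congr rfl fun e _ => ?_
  rw [div_eq_inv_mul]

/-- The contractions of the normal form converge, and its coefficients are Gaussian. -/
lemma normalForm_summable_and_amplitude (U : Matrix (Fin s) (Fin s) ℂ) (r : Fin s → ℝ)
    (n : Fin s → ℕ) :
    (Summable fun ℓ : (gbsNormalForm U r).Labelling n => (gbsNormalForm U r).weight ℓ.1) ∧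
      (gbsNormalForm U r).amplitude n =
        (∏ i, ((1 / √(Real.cosh (r i)) : ℝ) : ℂ)) * (√(∏ i, ((n i)! : ℝ)) : ℝ) *
          gaussCoeff U (fun j => -(Real.tanh (r j) / 2 : ℝ)) n := by
  have hsc : (gbsNormalForm U r).scalar = ∏ i, ((1 / √(Real.cosh (r i)) : ℝ) : ℂ) := by
    simp [gbsNormalForm, graphDiagram]
  have hinj : Function.Injective (graphLabel (s := s)) := by
    intro k l h
    funext e
    cases e with
    | inl p =>
      have := congrFun h (.half ⟨(p.1.1, p.1.2), p.2.ne⟩)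
      simpa only [graphLabel, edgeOf_of_lt] using this
    | inr i => exact congrFun h (.loop i false)
  have h := summable_and_amplitude_eq (gbsNormalForm U r) n (edgeNumbers n) graphLabel
    (fun k hk i => mem_edgeNumbers.1 hk i) hinj
    (fun ℓ hℓ hw => ⟨graphNumbers ℓ, mem_edgeNumbers.2 fun i => ?_,
      graph_label_of_weight_ne_zero _ _ _ ℓ hw⟩)
  · refine ⟨h.1, h.2.trans ?_⟩
    have hw : ∀ k, (gbsNormalForm U r).weight (graphLabel k) = _ :=
      graph_weight_graphLabel (edgeMatrix U r) (loopLabel U r) _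
    rw [gaussCoeff_eq_sum_edgeNumbers, hsc, Finset.mul_sum, Finset.mul_sum]
    refine Finset.sum_congr rfl fun k hk => ?_
    rw [hw, ← mul_assoc]
    simp only [mem_edgeNumbers.1 hk]
  · exact (congrFun (graph_label_of_weight_ne_zero _ _ _ ℓ hw) (.out i)).trans (hℓ i)

/-! ### Convergence in `L²` -/

lemma summable_amplitude_smul_fockKet {U : Matrix (Fin s) (Fin s) ℂ}
    (hU : U ∈ Matrix.unitaryGroup (Fin s) ℂ) (r : Fin s → ℝ) :
    Summable fun n => (gbsCircuit U r).amplitude n • fockKet n := by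
  refine ((orthonormal_fockKet s).orthogonalFamily.summable_iff_norm_sq_summable
    fun n => (gbsCircuit U r).amplitude n).2 ?_
  have hτ : ∀ j, (2 * ‖(-(Real.tanh (r j) / 2 : ℝ) : ℂ)‖) ^ 2 < 1 := by
    intro j
    rw [norm_neg, Complex.norm_real, Real.norm_eq_abs, mul_pow, sq_abs, div_pow]
    have h := Real.tanh_sq_lt_one (r j)
    linarith
  have h := (summable_gaussCoeff hU hτ).mul_left
    (‖∏ i, ((1 / √(Real.cosh (r i)) : ℝ) : ℂ)‖ ^ 2)
  refine h.congr fun n => ?_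
  rw [(circuit_summable_and_amplitude U r n).2, norm_mul, norm_mul, mul_pow, mul_pow,
    Complex.norm_real, Real.norm_eq_abs, sq_abs, Real.sq_sqrt (by positivity), mul_assoc]

end FockZX

end

theorem mainTheorem3 (s : ℕ) (U : Matrix (Fin s) (Fin s) ℂ)
    (hU : U ∈ Matrix.unitaryGroup (Fin s) ℂ) (r : Fin s → ℝ) :
    (∀ n : Fin s → ℕ,
      (FockZX.gbsCircuit U r).amplitude n = (FockZX.gbsNormalForm U r).amplitude n) ∧
    ∃ Ψ : MeasureTheory.Lp ℂ 2 (MeasureTheory.volume : MeasureTheory.Measure (Fin s → ℝ)),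
      (FockZX.gbsCircuit U r).Denotes Ψ ∧ (FockZX.gbsNormalForm U r).Denotes Ψ := by
  have h : ∀ n : Fin s → ℕ,
      (FockZX.gbsCircuit U r).amplitude n = (FockZX.gbsNormalForm U r).amplitude n := fun n =>
    (FockZX.circuit_summable_and_amplitude U r n).2.trans
      (FockZX.normalForm_summable_and_amplitude U r n).2.symm
  have hs := (FockZX.summable_amplitude_smul_fockKet hU r).hasSum
  refine ⟨h, _, ⟨fun n => (FockZX.circuit_summable_and_amplitude U r n).1, hs⟩,
    fun n => (FockZX.normalForm_summable_and_amplitude U r n).1, ?_⟩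
  simpa only [h] using hs
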